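/- Let $\mathcal B$ be a modular category over $\mathbb C$, that is, a ribbon fusion category (semisimple abelian $\mathbb C$-linear rigid braided monoidal category with finite-dimensional Hom spaces, finitely many simple objects up to isomorphism, simple unit object and a compatible twist $\theta$) whose matrix of Hopf link invariants of simple objects is invertible. Let $a,b,c,\dots$ label the isomorphism classes of simple objects, with $0$ the label of the unit object, and fix a representative of each. Let $\theta_a$ be the twist, $d_a$ the quantum dimension, $D$ the positive square root of $\sum_a d_a^2$, $S_{ab}=\frac1D \mathrm{Tr}_q(\beta_{b^*,a}\beta_{a,b^*})$ the modular $S$-matrix ($\beta$ is the braiding), and $T_{ab}=\theta_a\delta_{ab}$; $^*$ on matrix entries denotes complex conjugation. Write $R^{ab}:a\otimes b\to b\otimes a$ for the braiding. For any basis $(v_\mu)$ of $\mathrm{Hom}(c,a\otimes a)$ let $[R^{aa}_c]_{\mu\nu}$ be the matrix of the map $v\mapsto R^{aa}\circ v$ in this basis. For a two-strand braid let $Z$ of its closure be the (unnormalized, blackboard framed, coloured) invariant obtained by evaluating the closure diagram in $\mathcal B$, i.e. both strands are closed up by cups and caps on the right, and let $\mathrm{Tr}_q$ be the quantum trace. 1.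 For every $a$ and every $n\in\mathbb Z$, the invariant of the knot that is the closure of $\sigma_1^{2n+1}$, coloured by $a$, is $$Z(\widehat{\sigma_1^{2n+1}})=\mathrm{Tr}_q\big[(R^{aa})^{2n+1}\big]=\sum_c d_c\Big(\sum_\mu [R^{aa}_c]_{\mu\mu}\Big)\Big(\frac{\theta_c}{\theta_a^2}\Big)^n .$$ 2. For all $a,b$ and every $n\in\mathbb Z$, the invariant of the closure of $\sigma_1^{2n}$, with components coloured by $a$ and $b$, is $$Z(\widehat{\sigma_1^{2n}})=\mathrm{Tr}_q\big[(R^{ab}R^{ba})^{n}\big]=\sum_{c,z} d_c\,\frac{S_{az}S_{bz}S_{cz}^*}{S_{0z}}\Big(\frac{\theta_c}{\theta_a\theta_b}\Big)^n .$$ 3. All these invariants are determined by the modular data: if $\mathcal B$ and $\mathcal B'$ are modular categories and a bijection $e$ between their labels sends $0$ to $0$ and satisfies $S'_{e(a)e(b)}=S_{ab}$ and $T'_{e(a)e(b)}=T_{ab}$ for all $a,b$, then for all $a,b$ and $n\in\mathbb Z$ the closure of $\sigma_1^{2n+1}$ coloured by $a$ in $\mathcal B$ and by $e(a)$ in $\mathcal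 B'$ has the same invariant, and so has the closure of $\sigma_1^{2n}$ coloured by $(a,b)$ and by $(e(a),e(b))$. -/

import Mathlib

open CategoryTheory MonoidalCategory CategoryTheory.Limits
open scoped ComplexConjugate

universe v u w v' u' w' k

/-- A ribbon category: a rigid braided monoidal category with a twist `θ`, i.e. a natural
automorphism of the identity functor which is compatible with the tensor product (through the
double braiding) and with duals. -/
class RibbonCategory (C : Type u) [Category.{v} C] [MonoidalCategory C] [BraidedCategory C]
    [RigidCategory C] where
  /-- the twist `θ_A` -/
  twist (A : C) : A ≅ A
  twist_naturality {A B : C} (f : A ⟶ B) : (twist A).hom ≫ f = f ≫ (twist B).hom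
  twist_tensor (A B : C) : (twist (A ⊗ B)).hom =
    ((twist A).hom ⊗ₘ (twist B).hom) ≫ (β_ A B).hom ≫ (β_ B A).hom
  twist_dual (A : C) : (twist (Aᘁ)).hom = ((twist A).hom)ᘁ

section Trace

variable {C : Type u} [Category.{v} C] [MonoidalCategory C] [BraidedCategory C] [RigidCategory C]
  [RibbonCategory C]

/-- The cap `A ⊗ A* ⟶ 𝟙` of the graphical calculus on a strand that goes up and then down on its
right; it is obtained from `A* ⊗ A ⟶ 𝟙` by the braiding and the twist. The matching cup
`𝟙 ⟶ A ⊗ A*` is the coevaluation `η_ A Aᘁ`. -/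
def rightCap (A : C) : A ⊗ Aᘁ ⟶ 𝟙_ C :=
  (RibbonCategory.twist A).hom ▷ Aᘁ ≫ (β_ A Aᘁ).hom ≫ ε_ A Aᘁ

/-- The quantum trace of `f : A ⟶ A`, as an endomorphism of the unit object. -/
def qTraceHom {A : C} (f : A ⟶ A) : 𝟙_ C ⟶ 𝟙_ C :=
  η_ A Aᘁ ≫ f ▷ Aᘁ ≫ rightCap A

/-- The partial closure of an operator on two strands: the right strand, coloured by `B`, is
closed up on the right. -/
def closeRightStrand {A B : C} (f : A ⊗ B ⟶ A ⊗ B) : A ⟶ A :=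
  (ρ_ A).inv ≫ A ◁ η_ B Bᘁ ≫ (α_ A B Bᘁ).inv ≫ f ▷ Bᘁ ≫ (α_ A B Bᘁ).hom ≫
    A ◁ rightCap B ≫ (ρ_ A).hom

/-- The evaluation of the planar closure of an operator on two strands: first the right strand is
closed up by a cup and a cap, then the left strand is closed up around it. -/
def closureHom {A B : C} (f : A ⊗ B ⟶ A ⊗ B) : 𝟙_ C ⟶ 𝟙_ C :=
  qTraceHom (closeRightStrand f)

end Trace

section Braids

variable {C : Type u} [Category.{v} C] [MonoidalCategory C] [BraidedCategory C]

/-- The braiding `R^{AA}` as an automorphism of `A ⊗ A`. -/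
def selfBraiding (A : C) : Aut (A ⊗ A) := β_ A A

/-- The double braiding `A ⊗ B ⟶ B ⊗ A ⟶ A ⊗ B` as an automorphism of `A ⊗ B`. -/
def doubleBraiding (A B : C) : Aut (A ⊗ B) := β_ A B ≪≫ β_ B A

/-- The operator `(R^{AA})^{2n+1}` of the braid `σ₁^{2n+1}` with both strands coloured by `A`. -/
def oddBraid (A : C) (n : ℤ) : A ⊗ A ⟶ A ⊗ A := (selfBraiding A ^ (2 * n + 1)).hom

/-- The operator `(R^{AB} R^{BA})^n` of the pure braid `σ₁^{2n}` with strands coloured by `A`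
and `B`. -/
def evenBraid (A B : C) (n : ℤ) : A ⊗ B ⟶ A ⊗ B := (doubleBraiding A B ^ n).hom

end Braids

/-- A labelling by `ι` of the isomorphism classes of simple objects, with chosen representatives.
The label `zero` is the one of the unit object. -/
structure SimpleObjects (C : Type u) [Category.{v} C] [HasZeroMorphisms C] [MonoidalCategory C]
    (ι : Type w) where
  /-- the representative of a label -/
  obj : ι → C
  simple : ∀ i, Simple (obj i)
  eq_of_iso : ∀ i j, Nonempty (obj i ≅ obj j) → i = j
  exhaustive : ∀ A : C, Simple A → ∃ i, Nonempty (A ≅ obj i)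
  /-- the label of the unit object -/
  zero : ι
  unit_iso : Nonempty (obj zero ≅ 𝟙_ C)

attribute [instance] SimpleObjects.simple

attribute [local instance] Abelian.hasFiniteBiproducts

/-- A fusion category over `ℂ`: (rigid, abelian, `ℂ`-linear, monoidal and) semisimple with
finite-dimensional hom spaces, finitely many simple objects up to isomorphism, and a simple
unit object. -/
class IsFusionCategory (C : Type u) [Category.{v} C] [Abelian C] [Linear ℂ C]
    [MonoidalCategory C] [MonoidalPreadditive C] [MonoidalLinear ℂ C] [RigidCategory C] :
    Prop where
  finiteDimensional_hom : ∀ A B : C, FiniteDimensional ℂ (A ⟶ B)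
  semisimple : ∀ A : C, ∃ (m : ℕ) (f : Fin m → C),
    (∀ i, Simple (f i)) ∧ Nonempty (A ≅ ⨁ f)
  finitely_many : ∃ m : ℕ, Nonempty (SimpleObjects C (Fin m))
  simple_unit : Simple (𝟙_ C)

attribute [instance] IsFusionCategory.finiteDimensional_hom IsFusionCategory.simple_unit

section Scalars

variable {C : Type u} [Category.{v} C] [Abelian C] [Linear ℂ C] [MonoidalCategory C]
  [MonoidalPreadditive C] [MonoidalLinear ℂ C] [RigidCategory C] [IsFusionCategory C]

/-- The scalar by which an endomorphism of a simple object acts. -/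
noncomputable def scalarOf {A : C} [Simple A] (f : A ⟶ A) : ℂ :=
  (endomorphism_simple_eq_smul_id ℂ f).choose

theorem scalarOf_spec {A : C} [Simple A] (f : A ⟶ A) : scalarOf f • 𝟙 A = f :=
  (endomorphism_simple_eq_smul_id ℂ f).choose_spec

variable [BraidedCategory C] [RibbonCategory C]

/-- The quantum trace `Tr_q f`. -/
noncomputable def qTrace {A : C} (f : A ⟶ A) : ℂ := scalarOf (qTraceHom f)

/-- The invariant of the (blackboard framed) closure of a two-strand braid with operator `f`. -/
noncomputable def closureInvariant {A B : C} (f : A ⊗ B ⟶ A ⊗ B) : ℂ := scalarOf (closureHom f)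

/-- The invariant of the Hopf link with components coloured by `A` and `B`, oriented so that it is
the trace of the double braiding of `A` with the dual of `B`. -/
noncomputable def hopfLink (A B : C) : ℂ := qTrace ((β_ A Bᘁ).hom ≫ (β_ Bᘁ A).hom)

/-- The `R` symbols `[R^{AB}_E]_{μν}`: the coefficients of the braiding
`Hom(E, A ⊗ B) → Hom(E, B ⊗ A)` in given bases. -/
noncomputable def rSymbol {A B E : C} {κ : Type*} {κ' : Type*}
    (b : Module.Basis κ ℂ (E ⟶ A ⊗ B)) (b' : Module.Basis κ' ℂ (E ⟶ B ⊗ A)) : Matrix κ κ' ℂ :=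
  fun μ ν => b'.repr (b μ ≫ (β_ A B).hom) ν

namespace SimpleObjects

variable {ι : Type w} (X : SimpleObjects C ι)

/-- The quantum dimension `d_a`. -/
noncomputable def d (a : ι) : ℂ := qTrace (𝟙 (X.obj a))

/-- The topological twist `θ_a`. -/
noncomputable def θ (a : ι) : ℂ := scalarOf (RibbonCategory.twist (X.obj a)).hom

/-- The total dimension `D`, the positive square root of `∑ d_a²` (the `d_a` are real numbers). -/
noncomputable def D [Fintype ι] : ℝ := Real.sqrt (∑ a, X.d a ^ 2).re

/-- The modular `S`-matrix. -/
noncomputable def S [Fintype ι] : Matrix ι ι ℂ :=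
  fun a b => (1 / (X.D : ℂ)) * hopfLink (X.obj a) (X.obj b)

/-- The modular `T`-matrix. -/
noncomputable def T [DecidableEq ι] : Matrix ι ι ℂ := Matrix.diagonal X.θ

/-- The invariant of the closure of `σ₁^{2n+1}` coloured by `a`. -/
noncomputable def oddClosure (a : ι) (n : ℤ) : ℂ := closureInvariant (oddBraid (X.obj a) n)

/-- The invariant of the closure of `σ₁^{2n}` with components coloured by `a` and `b`. -/
noncomputable def evenClosure (a b : ι) (n : ℤ) : ℂ :=
  closureInvariant (evenBraid (X.obj a) (X.obj b) n)

end SimpleObjects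

end Scalars

/-- A modular category: a ribbon fusion category over `ℂ` whose matrix of Hopf link invariants of
simple objects is invertible. -/
class IsModularCategory (C : Type u) [Category.{v} C] [Abelian C] [Linear ℂ C]
    [MonoidalCategory C] [MonoidalPreadditive C] [MonoidalLinear ℂ C] [RigidCategory C]
    [BraidedCategory C] [RibbonCategory C] : Prop extends IsFusionCategory C where
  nondegenerate : ∀ (m : ℕ) (X : SimpleObjects C (Fin m)),
    IsUnit (Matrix.of fun i j => hopfLink (X.obj i) (X.obj j)).det

section SameModularData

variable {C : Type u} [Category.{v} C] [Abelian C] [Linear ℂ C] [MonoidalCategory C]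
  [MonoidalPreadditive C] [MonoidalLinear ℂ C] [RigidCategory C] [BraidedCategory C]
  [RibbonCategory C] [IsFusionCategory C]
  {C' : Type u'} [Category.{v'} C'] [Abelian C'] [Linear ℂ C'] [MonoidalCategory C']
  [MonoidalPreadditive C'] [MonoidalLinear ℂ C'] [RigidCategory C'] [BraidedCategory C']
  [RibbonCategory C'] [IsFusionCategory C']

/-- The bijection `e` of labels identifies the modular data: it preserves the unit label and
the entries of the `S`- and `T`-matrices. -/
structure SameModularData {ι : Type w} {ι' : Type w'} [Fintype ι] [DecidableEq ι] [Fintype ι']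
    [DecidableEq ι'] (X : SimpleObjects C ι) (X' : SimpleObjects C' ι') (e : ι ≃ ι') : Prop where
  zero_eq : e X.zero = X'.zero
  S_eq : ∀ a b, X'.S (e a) (e b) = X.S a b
  T_eq : ∀ a b, X'.T (e a) (e b) = X.T a b

end SameModularData

/-! Every linear functional on endomorphisms that is cyclic, `Φ (f ≫ g) = Φ (g ≫ f)`, is a
combination of the traces on the multiplicity spaces `Hom(c, A)`, weighted by its values on simple
identities (`cyclic_eq_sum`). Applied to the quantum trace this gives `Tr_q f = ∑ d_c · tr(f |
Hom(c, A))`. By naturality of the twist the double braiding acts on `Hom(c, a ⊗ b)` as `θ_c / (θ_a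
θ_b)` (`comp_doubleBraiding_hom`). This yields the knot formula, and the link formula with `dim
Hom(c, a ⊗ b)` in place of the sum over `z`; the Verlinde formula (`verlinde`) expresses that
dimension through `S`. The planar closure is a quantum trace because the cap of a tensor product is
the nested cap (`pairingCap_tensor`, `closureHom_eq_qTraceHom`).

For `verlinde`, the scalar by which a loop `a` around a strand `z` acts is a character of the fusion
ring. Duality of fusion multiplicities and nondegeneracy make distinct characters orthogonal.

Even closures then visibly depend on `S` and `T` only. For odd ones the unknowns are `tr(R^{aa} |
Hom(c, a ⊗ a))`. Encircle the closure of one crossing by a loop `z`. Expanding over `c` gives these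
unknowns paired with the Hopf matrix, while two Yang–Baxter moves and the removal of a curl give
`θ_a` times the closure of `σ₁⁴` coloured by `z, a` (`qTraceHom_braiding_encircled`). The right side
is modular data and the Hopf matrix is invertible, so the unknowns are determined
(`homTrace_braiding_eq`). -/

/-! ### Partial traces along arbitrary cups and caps. -/

section PartialTrace

variable {C : Type u} [Category.{v} C] [MonoidalCategory C]

/-- The partial trace of `f` over its right strand along an arbitrary cup and cap. -/
def partialTrace {Z W X Y : C} (cup : 𝟙_ C ⟶ X ⊗ Y) (cap : X ⊗ Y ⟶ 𝟙_ C)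
    (f : Z ⊗ X ⟶ W ⊗ X) : Z ⟶ W :=
  (ρ_ Z).inv ≫ Z ◁ cup ≫ (α_ Z X Y).inv ≫ f ▷ Y ≫ (α_ W X Y).hom ≫ W ◁ cap ≫ (ρ_ W).hom

/-- The morphism `g` travels around the loop: through the cap it becomes `u` on the returning
strand, and through the cup it becomes `g` again. -/
theorem partialTrace_slide {Z W X Y X' Y' : C} {cup : 𝟙_ C ⟶ X ⊗ Y} {cap : X ⊗ Y ⟶ 𝟙_ C}
    {cup' : 𝟙_ C ⟶ X' ⊗ Y'} {cap' : X' ⊗ Y' ⟶ 𝟙_ C} {g : X' ⟶ X} {u : Y ⟶ Y'}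
    (hcup : cup ≫ X ◁ u = cup' ≫ g ▷ Y') (hcap : g ▷ Y ≫ cap = X' ◁ u ≫ cap')
    (f : Z ⊗ X ⟶ W ⊗ X') :
    partialTrace cup cap (f ≫ W ◁ g) = partialTrace cup' cap' (Z ◁ g ≫ f) := by
  calc
    _ = (ρ_ Z).inv ≫ Z ◁ cup ≫ (α_ Z X Y).inv ≫ f ▷ Y ≫ (α_ W X' Y).hom ≫
          W ◁ (g ▷ Y ≫ cap) ≫ (ρ_ W).hom := by
      simp [partialTrace]
    _ = (ρ_ Z).inv ≫ Z ◁ (cup ≫ X ◁ u) ≫ (α_ Z X Y').inv ≫ f ▷ Y' ≫ (α_ W X' Y').hom ≫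
          W ◁ cap' ≫ (ρ_ W).hom := by
      rw [hcap]
      have h : Z ◁ X ◁ u ≫ (α_ Z X Y').inv ≫ f ▷ Y' = (α_ Z X Y).inv ≫ f ▷ Y ≫
          (α_ W X' Y).hom ≫ W ◁ X' ◁ u ≫ (α_ W X' Y').inv := by
        calc
          _ = 𝟙 _ ⊗≫ ((Z ⊗ X) ◁ u ≫ f ▷ Y') := by monoidal
          _ = _ := by
            rw [whisker_exchange]
            monoidal
      simp [reassoc_of% h]
    _ = _ := by
      rw [hcup]
      simp [partialTrace]

theorem partialTrace_whiskerRight {Z Z' W W' X Y : C} (cup : 𝟙_ C ⟶ X ⊗ Y)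
    (cap : X ⊗ Y ⟶ 𝟙_ C) (g : Z ⟶ Z') (f : Z' ⊗ X ⟶ W ⊗ X) (g' : W ⟶ W') :
    partialTrace cup cap (g ▷ X ≫ f ≫ g' ▷ X) = g ≫ partialTrace cup cap f ≫ g' := by
  simp only [partialTrace]
  calc
    _ = 𝟙 Z ⊗≫ (Z ◁ cup ≫ g ▷ (X ⊗ Y)) ⊗≫ f ▷ Y ⊗≫ (g' ▷ (X ⊗ Y) ≫ W' ◁ cap) ⊗≫ 𝟙 W' := by
      monoidal
    _ = _ := by
      rw [whisker_exchange g cup, ← whisker_exchange g' cap]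
      monoidal

theorem partialTrace_whiskerLeft {Z W X Y : C} (cup : 𝟙_ C ⟶ X ⊗ Y)
    (cap : X ⊗ Y ⟶ 𝟙_ C) (A : C) (f : Z ⊗ X ⟶ W ⊗ X) :
    partialTrace cup cap ((α_ A Z X).hom ≫ A ◁ f ≫ (α_ A W X).inv) =
      A ◁ partialTrace cup cap f := by
  simp only [partialTrace]
  monoidal

theorem partialTrace_tensor {Z W X Y X' Y' : C} (cup : 𝟙_ C ⟶ X ⊗ Y) (cap : X ⊗ Y ⟶ 𝟙_ C)
    (cup' : 𝟙_ C ⟶ X' ⊗ Y') (cap' : X' ⊗ Y' ⟶ 𝟙_ C) (f : Z ⊗ (X ⊗ X') ⟶ W ⊗ (X ⊗ X')) :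
    partialTrace (cup ⊗≫ (X ◁ cup') ▷ Y ⊗≫ 𝟙 ((X ⊗ X') ⊗ (Y' ⊗ Y)))
      (𝟙 ((X ⊗ X') ⊗ (Y' ⊗ Y)) ⊗≫ (X ◁ cap') ▷ Y ⊗≫ cap) f =
    partialTrace cup cap
      (partialTrace cup' cap' ((α_ Z X X').hom ≫ f ≫ (α_ W X X').inv)) := by
  simp only [partialTrace]
  monoidal

/-- Allowing arbitrary exact pairings makes it possible to replace the chosen dual of `A ⊗ B` by `Bᘁ
⊗ Aᘁ`. -/
theorem exists_rightMate {X' Y' X Y : C} [ExactPairing X Y] [ExactPairing X' Y'] (g : X' ⟶ X) :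
    ∃ u : Y ⟶ Y', η_ X Y ≫ X ◁ u = η_ X' Y' ≫ g ▷ Y' ∧
      u ▷ X' ≫ ε_ X' Y' = Y ◁ g ≫ ε_ X Y := by
  let : HasRightDual X := ⟨Y⟩
  let : HasRightDual X' := ⟨Y'⟩
  exact ⟨rightAdjointMate g, coevaluation_comp_rightAdjointMate g,
    rightAdjointMate_comp_evaluation g⟩

end PartialTrace

/-! ### Isotopies of braided diagrams. -/

section Braided

variable {C : Type u} [Category.{v} C] [MonoidalCategory C] [BraidedCategory C]

/-- A strand crossing both legs of a cap can be pulled off it, by the hexagon and naturality of the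
braiding. -/
theorem braiding_tensor_right_comp_whiskerRight {A X Y : C} (f : X ⊗ Y ⟶ 𝟙_ C) :
    (β_ A X).hom ▷ Y ⊗≫ X ◁ (β_ A Y).hom ⊗≫ f ▷ A = 𝟙 _ ⊗≫ A ◁ f ⊗≫ 𝟙 _ := by
  calc
    _ = 𝟙 _ ⊗≫ ((β_ A (X ⊗ Y)).hom ≫ f ▷ A) ⊗≫ 𝟙 _ := by
      rw [BraidedCategory.braiding_tensor_right_hom]
      monoidal
    _ = _ := by
      rw [← BraidedCategory.braiding_naturality_right, braiding_tensorUnit_right]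
      monoidal

/-- The double braiding in the twist of `A ⊗ B` is exactly what unlinks the two caps: strand `B` is
pulled through the cap of `A`, then strand `A` through the cap of `B`. -/
theorem doubleBraiding_whiskerRight_braiding_evaluation (A A' B B' : C) [ExactPairing A A']
    [ExactPairing B B'] :
    ((β_ A B).hom ≫ (β_ B A).hom) ▷ (B' ⊗ A') ≫ (β_ (A ⊗ B) (B' ⊗ A')).hom ≫
        ε_ (A ⊗ B) (B' ⊗ A') =
      𝟙 _ ⊗≫ (A ◁ ((β_ B B').hom ≫ ε_ B B')) ▷ A' ⊗≫ (β_ A A').hom ≫ ε_ A A' := by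
  calc
    _ = (β_ A B).hom ▷ (B' ⊗ A') ≫ (β_ (B ⊗ A) (B' ⊗ A')).hom ≫ (B' ⊗ A') ◁ (β_ B A).hom ≫
          ε_ (A ⊗ B) (B' ⊗ A') := by
      rw [comp_whiskerRight_assoc, BraidedCategory.braiding_naturality_left_assoc]
    _ = (β_ A B).hom ▷ (B' ⊗ A') ⊗≫ B ◁ (β_ A B').hom ▷ A' ⊗≫ (B ⊗ B') ◁ (β_ A A').hom ⊗≫
          (β_ B B').hom ▷ (A' ⊗ A) ⊗≫
          B' ◁ ((β_ B A').hom ▷ A ⊗≫ A' ◁ (β_ B A).hom ⊗≫ ε_ A A' ▷ B) ⊗≫ ε_ B B' := by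
      rw [ExactPairing.tensor_evaluation, BraidedCategory.braiding_tensor_left_hom,
        BraidedCategory.braiding_tensor_right_hom, BraidedCategory.braiding_tensor_right_hom]
      monoidal
    _ = (β_ A B).hom ▷ (B' ⊗ A') ⊗≫ B ◁ (β_ A B').hom ▷ A' ⊗≫
          ((B ⊗ B') ◁ ((β_ A A').hom ≫ ε_ A A') ≫ ((β_ B B').hom ≫ ε_ B B') ▷ 𝟙_ C) ⊗≫ 𝟙 _ := by
      rw [braiding_tensor_right_comp_whiskerRight]
      have h := whisker_exchange (β_ B B').hom (ε_ A A')
      calc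
        _ = (β_ A B).hom ▷ (B' ⊗ A') ⊗≫ B ◁ (β_ A B').hom ▷ A' ⊗≫ (B ⊗ B') ◁ (β_ A A').hom ⊗≫
              ((β_ B B').hom ▷ (A' ⊗ A) ≫ (B' ⊗ B) ◁ ε_ A A') ⊗≫ ε_ B B' := by
          monoidal
        _ = _ := by
          rw [← h]
          monoidal
    _ = 𝟙 _ ⊗≫ ((β_ A B).hom ▷ B' ⊗≫ B ◁ (β_ A B').hom ⊗≫ ((β_ B B').hom ≫ ε_ B B') ▷ A) ▷ A' ⊗≫
          (β_ A A').hom ≫ ε_ A A' := by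
      rw [whisker_exchange]
      monoidal
    _ = _ := by
      rw [braiding_tensor_right_comp_whiskerRight]
      monoidal

/-- Two Yang–Baxter moves pull the crossing of the two `A` strands into the middle of the full turn
around `Z`. Afterwards `Z` winds only around the adjacent `A` strand, once before and once after the
crossing. -/
theorem braiding_whiskerLeft_braiding (A Z : C) :
    (β_ Z (A ⊗ A)).hom ≫ (β_ (A ⊗ A) Z).hom ≫ Z ◁ (β_ A A).hom =
      (α_ Z A A).inv ≫ ((β_ Z A).hom ≫ (β_ A Z).hom) ▷ A ≫
        ((α_ Z A A).hom ≫ Z ◁ (β_ A A).hom ≫ (α_ Z A A).inv) ≫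
        ((β_ Z A).hom ≫ (β_ A Z).hom) ▷ A ≫ (α_ Z A A).hom := by
  calc
    _ = 𝟙 _ ⊗≫ (β_ Z A).hom ▷ A ⊗≫ A ◁ (β_ Z A).hom ⊗≫
          (𝟙 ((A ⊗ A) ⊗ Z) ⊗≫ (A ◁ (β_ A Z).hom ⊗≫ (β_ A Z).hom ▷ A ⊗≫ Z ◁ (β_ A A).hom) ⊗≫
            𝟙 ((Z ⊗ A) ⊗ A)) ⊗≫ 𝟙 _ := by
      rw [BraidedCategory.braiding_tensor_right_hom, BraidedCategory.braiding_tensor_left_hom]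
      monoidal
    _ = 𝟙 _ ⊗≫ (β_ Z A).hom ▷ A ⊗≫ (𝟙 ((A ⊗ Z) ⊗ A) ⊗≫
          (A ◁ (β_ Z A).hom ⊗≫ (β_ A A).hom ▷ Z ⊗≫ A ◁ (β_ A Z).hom) ⊗≫ 𝟙 ((A ⊗ Z) ⊗ A)) ⊗≫ (β_ A Z).hom ▷ A ⊗≫ 𝟙 _ := by
      rw [← BraidedCategory.yang_baxter']
      monoidal
    _ = _ := by
      rw [← BraidedCategory.yang_baxter']
      monoidal

/-- The double braiding is compatible with morphisms in the left strand. -/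
theorem whiskerRight_comp_doubleBraiding {A A' : C} (f : A ⟶ A') (B : C) :
    f ▷ B ≫ (β_ A' B).hom ≫ (β_ B A').hom = ((β_ A B).hom ≫ (β_ B A).hom) ≫ f ▷ B := by
  rw [BraidedCategory.braiding_naturality_left_assoc, BraidedCategory.braiding_naturality_right,
    Category.assoc]

end Braided

/-! ### Graphical calculus of the quantum trace in a ribbon category. -/

section Ribbon

variable {C : Type u} [Category.{v} C] [MonoidalCategory C] [BraidedCategory C] [RigidCategory C]
  [RibbonCategory C]

/-- The cap `X ⊗ Y ⟶ 𝟙` obtained from an exact pairing by the twist and the braiding. -/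
def pairingCap (X Y : C) [ExactPairing X Y] : X ⊗ Y ⟶ 𝟙_ C :=
  (RibbonCategory.twist X).hom ▷ Y ≫ (β_ X Y).hom ≫ ε_ X Y

theorem closeRightStrand_eq {A B : C} (f : A ⊗ B ⟶ A ⊗ B) :
    closeRightStrand f = partialTrace (η_ B Bᘁ) (pairingCap B Bᘁ) f := rfl

theorem whiskerRight_pairingCap {X Y X' Y' : C} [ExactPairing X Y] [ExactPairing X' Y']
    {g : X' ⟶ X} {u : Y ⟶ Y'} (h : u ▷ X' ≫ ε_ X' Y' = Y ◁ g ≫ ε_ X Y) :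
    g ▷ Y ≫ pairingCap X Y = X' ◁ u ≫ pairingCap X' Y' := by
  simp only [pairingCap]
  rw [← comp_whiskerRight_assoc, ← RibbonCategory.twist_naturality, comp_whiskerRight_assoc,
    BraidedCategory.braiding_naturality_left_assoc, ← h, whisker_exchange_assoc,
    BraidedCategory.braiding_naturality_right_assoc]

theorem partialTrace_pairing {Z W X Y X' Y' : C} [ExactPairing X Y] [ExactPairing X' Y']
    (g : X' ⟶ X) (f : Z ⊗ X ⟶ W ⊗ X') :
    partialTrace (η_ X Y) (pairingCap X Y) (f ≫ W ◁ g) =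
      partialTrace (η_ X' Y') (pairingCap X' Y') (Z ◁ g ≫ f) := by
  obtain ⟨u, h₁, h₂⟩ := exists_rightMate (X' := X') (Y' := Y') (X := X) (Y := Y) g
  exact partialTrace_slide h₁ (whiskerRight_pairingCap h₂) f

theorem partialTrace_pairing_eq {Z W X Y Y' : C} [ExactPairing X Y] [ExactPairing X Y']
    (f : Z ⊗ X ⟶ W ⊗ X) :
    partialTrace (η_ X Y) (pairingCap X Y) f =
      partialTrace (η_ X Y') (pairingCap X Y') f := by
  simpa using partialTrace_pairing (Y := Y) (Y' := Y') (𝟙 X) f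

theorem closeRightStrand_slide {Z X X' : C} (g : X' ⟶ X) (f : Z ⊗ X ⟶ Z ⊗ X') :
    closeRightStrand (f ≫ Z ◁ g) = closeRightStrand (Z ◁ g ≫ f) :=
  partialTrace_pairing g f

theorem qTraceHom_eq_closeRightStrand {A : C} (f : A ⟶ A) :
    qTraceHom f = closeRightStrand (𝟙_ C ◁ f) := by
  simp only [qTraceHom, closeRightStrand]
  monoidal

theorem qTraceHom_comp_comm {A B : C} (f : A ⟶ B) (g : B ⟶ A) :
    qTraceHom (f ≫ g) = qTraceHom (g ≫ f) := by
  simp only [qTraceHom_eq_closeRightStrand, whiskerLeft_comp]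
  exact closeRightStrand_slide g (𝟙_ C ◁ f)

/-- The cap of a tensor product is the nested cap. -/
theorem pairingCap_tensor (A A' B B' : C) [ExactPairing A A'] [ExactPairing B B'] :
    pairingCap (A ⊗ B) (B' ⊗ A') =
      𝟙 _ ⊗≫ (A ◁ pairingCap B B') ▷ A' ⊗≫ pairingCap A A' := by
  simp only [pairingCap, RibbonCategory.twist_tensor, comp_whiskerRight, Category.assoc]
  have h := doubleBraiding_whiskerRight_braiding_evaluation A A' B B'
  simp only [comp_whiskerRight, Category.assoc] at h
  rw [h, MonoidalCategory.tensorHom_def]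
  calc
    _ = 𝟙 _ ⊗≫ A ◁ (RibbonCategory.twist B).hom ▷ (B' ⊗ A') ⊗≫
          ((RibbonCategory.twist A).hom ▷ (B ⊗ B') ≫ A ◁ ((β_ B B').hom ≫ ε_ B B')) ▷ A' ⊗≫
          (β_ A A').hom ≫ ε_ A A' := by
      have h := whisker_exchange (RibbonCategory.twist A).hom (RibbonCategory.twist B).hom
      rw [← h]
      monoidal
    _ = _ := by
      rw [← whisker_exchange]
      monoidal

theorem closeRightStrand_tensor {Z A B : C} (f : Z ⊗ (A ⊗ B) ⟶ Z ⊗ (A ⊗ B)) :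
    closeRightStrand f =
      closeRightStrand (closeRightStrand ((α_ Z A B).hom ≫ f ≫ (α_ Z A B).inv)) := by
  rw [closeRightStrand_eq, partialTrace_pairing_eq (Y' := Bᘁ ⊗ Aᘁ), pairingCap_tensor,
    ExactPairing.tensor_coevaluation]
  exact partialTrace_tensor _ _ _ _ f

theorem closeRightStrand_whiskerRight {Z W B : C} (g : Z ⟶ W) (f : W ⊗ B ⟶ W ⊗ B) (g' : W ⟶ Z) :
    closeRightStrand (g ▷ B ≫ f ≫ g' ▷ B) = g ≫ closeRightStrand f ≫ g' :=
  partialTrace_whiskerRight _ _ g f g'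

theorem closeRightStrand_whiskerLeft (A : C) {Z B : C} (f : Z ⊗ B ⟶ Z ⊗ B) :
    closeRightStrand ((α_ A Z B).hom ≫ A ◁ f ≫ (α_ A Z B).inv) = A ◁ closeRightStrand f :=
  partialTrace_whiskerLeft _ _ A f

theorem closureHom_eq_qTraceHom {A B : C} (f : A ⊗ B ⟶ A ⊗ B) : closureHom f = qTraceHom f := by
  rw [qTraceHom_eq_closeRightStrand, closeRightStrand_tensor, closeRightStrand_whiskerLeft,
    closureHom, qTraceHom_eq_closeRightStrand]

/-- Removal of a curl: the twist in the cap moves through the crossing to the incoming strand, the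
cup is pulled through the braiding, and a zigzag remains. -/
theorem closeRightStrand_braiding (A : C) :
    closeRightStrand (β_ A A).hom = (RibbonCategory.twist A).hom := by
  calc
    _ = 𝟙 A ⊗≫ A ◁ η_ A Aᘁ ⊗≫ ((β_ A A).hom ≫ A ◁ (RibbonCategory.twist A).hom) ▷ Aᘁ ⊗≫
          A ◁ ((β_ A Aᘁ).hom ≫ ε_ A Aᘁ) ⊗≫ 𝟙 A := by
      simp only [closeRightStrand, rightCap]
      monoidal
    _ = 𝟙 A ⊗≫ (A ◁ η_ A Aᘁ ≫ (RibbonCategory.twist A).hom ▷ (A ⊗ Aᘁ)) ⊗≫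
          (β_ A A).hom ▷ Aᘁ ⊗≫ A ◁ (β_ A Aᘁ).hom ⊗≫ A ◁ ε_ A Aᘁ ⊗≫ 𝟙 A := by
      rw [← BraidedCategory.braiding_naturality_left]
      monoidal
    _ = (RibbonCategory.twist A).hom ⊗≫ (A ◁ η_ A Aᘁ ≫ (β_ A (A ⊗ Aᘁ)).hom) ⊗≫
          A ◁ ε_ A Aᘁ ⊗≫ 𝟙 A := by
      rw [whisker_exchange, BraidedCategory.braiding_tensor_right_hom]
      monoidal
    _ = (RibbonCategory.twist A).hom ⊗≫ (η_ A Aᘁ ▷ A ⊗≫ A ◁ ε_ A Aᘁ) ⊗≫ 𝟙 A := by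
      rw [BraidedCategory.braiding_naturality_right, braiding_tensorUnit_right]
      monoidal
    _ = _ := by
      rw [ExactPairing.evaluation_coevaluation'']
      monoidal

/-- The trace may be computed with `A` as the dual of `Aᘁ`, paired through the braiding. The
crossings in cup and cap cancel, and compatibility of the twist with duals moves it to the other leg
of the loop. -/
theorem qTraceHom_id_rightDual (A : C) : qTraceHom (𝟙 Aᘁ) = qTraceHom (𝟙 A) := by
  let := BraidedCategory.exactPairing_swap A Aᘁ
  have h {X Y : C} [ExactPairing X Y] :
      partialTrace (η_ X Y) (pairingCap X Y) (𝟙_ C ◁ 𝟙 X) = η_ X Y ≫ pairingCap X Y := by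
    simp only [partialTrace]
    monoidal
  rw [qTraceHom_eq_closeRightStrand, qTraceHom_eq_closeRightStrand, closeRightStrand_eq,
    closeRightStrand_eq, partialTrace_pairing_eq (Y' := A), h, h]
  have hη : η_ Aᘁ A = η_ A Aᘁ ≫ (β_ Aᘁ A).inv := rfl
  have hε : ε_ Aᘁ A = (β_ A Aᘁ).hom ≫ ε_ A Aᘁ := rfl
  simp only [pairingCap, hη, hε, RibbonCategory.twist_dual]
  rw [BraidedCategory.braiding_naturality_left_assoc, Category.assoc, Iso.inv_hom_id_assoc,
    ← Category.assoc, coevaluation_comp_rightAdjointMate, Category.assoc]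

/-- The operator of a strand `Z` encircled by a closed strand `A`. -/
def encircle (Z A : C) : Z ⟶ Z := closeRightStrand ((β_ Z A).hom ≫ (β_ A Z).hom)

theorem encircle_tensor (Z A B : C) :
    encircle Z (A ⊗ B) = closeRightStrand
      ((β_ Z A).hom ≫ A ◁ encircle Z B ≫ (β_ A Z).hom) := by
  rw [encircle, closeRightStrand_tensor, encircle, ← closeRightStrand_whiskerLeft,
    ← closeRightStrand_whiskerRight]
  congr 2
  rw [BraidedCategory.braiding_tensor_right_hom, BraidedCategory.braiding_tensor_left_hom]
  monoidal

/-- Cyclicity of the functional that inserts an endomorphism into the encircling loop, as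
`cyclic_eq_sum` requires. -/
theorem braiding_comp_whiskerLeft_encircle {Z A B : C} (f : A ⟶ B) (g : B ⟶ A) :
    closeRightStrand (Z ◁ (f ≫ g) ≫ (β_ Z A).hom ≫ (β_ A Z).hom) =
      closeRightStrand (Z ◁ (g ≫ f) ≫ (β_ Z B).hom ≫ (β_ B Z).hom) := by
  have := closeRightStrand_slide g (Z ◁ f ≫ (β_ Z B).hom ≫ (β_ B Z).hom)
  simp only [Category.assoc, whiskerLeft_comp] at this ⊢
  rw [← this, ← BraidedCategory.braiding_naturality_left,
    ← BraidedCategory.braiding_naturality_right_assoc]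

theorem qTraceHom_tensor {A B D : C} (f : A ⊗ (B ⊗ D) ⟶ A ⊗ (B ⊗ D)) :
    qTraceHom f = qTraceHom (closeRightStrand ((α_ A B D).hom ≫ f ≫ (α_ A B D).inv)) := by
  rw [← closureHom, closureHom_eq_qTraceHom, qTraceHom_comp_comm, Category.assoc, Iso.inv_hom_id,
    Category.comp_id]

/-- The topological heart of the odd case. Once `Z` has been moved off the outer `A` strand, closing
that strand turns the remaining crossing into a twist, leaving two double braidings of `Z` with a
single `A`. -/
theorem qTraceHom_braiding_encircled (A Z : C) :
    qTraceHom ((β_ A A).hom ▷ Z ≫ (β_ (A ⊗ A) Z).hom ≫ (β_ Z (A ⊗ A)).hom) =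
      qTraceHom ((β_ Z A).hom ≫ (β_ A Z).hom ≫ Z ◁ (RibbonCategory.twist A).hom ≫
        (β_ Z A).hom ≫ (β_ A Z).hom) := by
  rw [BraidedCategory.braiding_naturality_left_assoc, ← Category.assoc, qTraceHom_comp_comm,
    braiding_whiskerLeft_braiding, qTraceHom_tensor]
  simp only [Category.assoc, Iso.hom_inv_id_assoc, Iso.hom_inv_id, Category.comp_id]
  have h := closeRightStrand_whiskerRight ((β_ Z A).hom ≫ (β_ A Z).hom)
    ((α_ Z A A).hom ≫ Z ◁ (β_ A A).hom ≫ (α_ Z A A).inv) ((β_ Z A).hom ≫ (β_ A Z).hom)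
  rw [closeRightStrand_whiskerLeft, closeRightStrand_braiding] at h
  simp only [Category.assoc] at h
  rw [h]

end Ribbon

/-! ### Ordinary traces on Hom spaces. -/

section HomTrace

variable {C : Type u} [Category.{v} C] [Preadditive C] [Linear ℂ C]

/-- The trace of `f` acting on `Hom(P, A)` by postcomposition. -/
noncomputable def homTrace (P A : C) : (A ⟶ A) →ₗ[ℂ] ℂ where
  toFun f := LinearMap.trace ℂ (P ⟶ A) (Linear.rightComp ℂ P f)
  map_add' f g := by
    rw [← map_add]
    congr 1
    ext
    simp
  map_smul' r f := by
    rw [RingHom.id_apply, ← map_smul]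
    congr 1
    ext
    simp

/-- The trace of `f` acting on `Hom(A, P)` by precomposition. -/
noncomputable def cohomTrace (P A : C) : (A ⟶ A) →ₗ[ℂ] ℂ where
  toFun f := LinearMap.trace ℂ (A ⟶ P) (Linear.leftComp ℂ P f)
  map_add' f g := by
    rw [← map_add]
    congr 1
    ext
    simp
  map_smul' r f := by
    rw [RingHom.id_apply, ← map_smul]
    congr 1
    ext
    simp

theorem homTrace_apply (P : C) {A : C} (f : A ⟶ A) :
    homTrace P A f = LinearMap.trace ℂ (P ⟶ A) (Linear.rightComp ℂ P f) := rfl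

theorem cohomTrace_apply (P : C) {A : C} (f : A ⟶ A) :
    cohomTrace P A f = LinearMap.trace ℂ (A ⟶ P) (Linear.leftComp ℂ P f) := rfl

variable [∀ A B : C, FiniteDimensional ℂ (A ⟶ B)]

theorem homTrace_comm (P : C) {A B : C} (f : A ⟶ B) (g : B ⟶ A) :
    homTrace P A (f ≫ g) = homTrace P B (g ≫ f) := by
  have h {A B D : C} (f : A ⟶ B) (g : B ⟶ D) : Linear.rightComp ℂ P (f ≫ g) =
      Linear.rightComp ℂ P g ∘ₗ Linear.rightComp ℂ P f := by
    ext
    simp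
  rw [homTrace_apply, homTrace_apply, h, h, LinearMap.trace_comp_comm']

theorem cohomTrace_comm (P : C) {A B : C} (f : A ⟶ B) (g : B ⟶ A) :
    cohomTrace P A (f ≫ g) = cohomTrace P B (g ≫ f) := by
  have h {A B D : C} (f : A ⟶ B) (g : B ⟶ D) : Linear.leftComp ℂ P (f ≫ g) =
      Linear.leftComp ℂ P f ∘ₗ Linear.leftComp ℂ P g := by
    ext
    simp
  rw [cohomTrace_apply, cohomTrace_apply, h, h, LinearMap.trace_comp_comm']

theorem homTrace_id (P A : C) : homTrace P A (𝟙 A) = Module.finrank ℂ (P ⟶ A) := by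
  have : Linear.rightComp ℂ P (𝟙 A) = LinearMap.id := by
    ext
    simp
  rw [homTrace_apply, this, LinearMap.trace_id]

theorem cohomTrace_id (P A : C) : cohomTrace P A (𝟙 A) = Module.finrank ℂ (A ⟶ P) := by
  have : Linear.leftComp ℂ P (𝟙 A) = LinearMap.id := by
    ext
    simp
  rw [cohomTrace_apply, this, LinearMap.trace_id]

end HomTrace

/-! ### Dimensions of Hom spaces under duality. -/

section Duality

variable {C : Type u} [Category.{v} C] [Preadditive C] [Linear ℂ C] [MonoidalCategory C]
  [MonoidalPreadditive C] [MonoidalLinear ℂ C]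

theorem finrank_tensor_left_hom (A A' B D : C) [ExactPairing A A'] :
    Module.finrank ℂ (A' ⊗ B ⟶ D) = Module.finrank ℂ (B ⟶ A ⊗ D) :=
  LinearEquiv.finrank_eq
    { tensorLeftHomEquiv B A A' D with
      map_add' := fun f g => by simp [tensorLeftHomEquiv]
      map_smul' := fun r f => by simp [tensorLeftHomEquiv] }

theorem finrank_tensor_right_hom (A A' B D : C) [ExactPairing A A'] :
    Module.finrank ℂ (B ⊗ A ⟶ D) = Module.finrank ℂ (B ⟶ D ⊗ A') :=
  LinearEquiv.finrank_eq
    { tensorRightHomEquiv B A A' D with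
      map_add' := fun f g => by simp [tensorRightHomEquiv]
      map_smul' := fun r f => by simp [tensorRightHomEquiv] }

theorem finrank_end_rightDual (A : C) [HasRightDual A] :
    Module.finrank ℂ (Aᘁ ⟶ Aᘁ) = Module.finrank ℂ (A ⟶ A) := by
  rw [← (Linear.homCongr ℂ (ρ_ Aᘁ) (Iso.refl Aᘁ)).finrank_eq, finrank_tensor_left_hom A,
    ← finrank_tensor_right_hom A, (Linear.homCongr ℂ (λ_ A) (Iso.refl A)).finrank_eq]

end Duality

/-! ### Semisimplicity, multiplicities and dual labels. -/

section Scalars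

variable {C : Type u} [Category.{v} C] [Abelian C] [Linear ℂ C] [MonoidalCategory C]
  [MonoidalPreadditive C] [MonoidalLinear ℂ C] [RigidCategory C] [IsFusionCategory C]

theorem scalarOf_eq {A : C} [Simple A] {f : A ⟶ A} {c : ℂ} (h : c • 𝟙 A = f) :
    scalarOf f = c := by
  have h' := (scalarOf_spec f).trans h.symm
  by_contra hne
  have : (scalarOf f - c) • 𝟙 A = 0 := by rw [sub_smul, h', sub_self]
  exact (smul_ne_zero (sub_ne_zero.2 hne) (id_nonzero A)) this

theorem scalarOf_add {A : C} [Simple A] (f g : A ⟶ A) :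
    scalarOf (f + g) = scalarOf f + scalarOf g :=
  scalarOf_eq (by rw [add_smul, scalarOf_spec, scalarOf_spec])

theorem scalarOf_smul {A : C} [Simple A] (c : ℂ) (f : A ⟶ A) :
    scalarOf (c • f) = c * scalarOf f :=
  scalarOf_eq (by rw [mul_smul, scalarOf_spec])

namespace SimpleObjects

variable {ι : Type w} (X : SimpleObjects C ι)

theorem exists_decomposition (A : C) : ∃ (m : ℕ) (l : Fin m → ι)
    (p : ∀ i, A ⟶ X.obj (l i)) (q : ∀ i, X.obj (l i) ⟶ A),
    ∑ i, p i ≫ q i = 𝟙 A ∧ ∀ i, q i ≫ p i = 𝟙 (X.obj (l i)) := by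
  obtain ⟨m, f, hf, ⟨e⟩⟩ := IsFusionCategory.semisimple A
  choose l hl using fun i => X.exhaustive (f i) (hf i)
  have g i := (hl i).some
  refine ⟨m, l, fun i => e.hom ≫ biproduct.π f i ≫ (g i).hom,
    fun i => (g i).inv ≫ biproduct.ι f i ≫ e.inv, ?_, ?_⟩
  · have h : ∑ i, (e.hom ≫ biproduct.π f i ≫ (g i).hom) ≫ ((g i).inv ≫ biproduct.ι f i ≫ e.inv) =
        e.hom ≫ (∑ i, biproduct.π f i ≫ biproduct.ι f i) ≫ e.inv := by
      rw [Preadditive.sum_comp, Preadditive.comp_sum]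
      exact Finset.sum_congr rfl fun i _ => by simp
    rw [h, biproduct.total]
    simp
  · intro i
    simp

/-- The multiplicity of the simple object `c` in `A`. -/
noncomputable def mult (c : ι) (A : C) : ℕ := Module.finrank ℂ (X.obj c ⟶ A)

theorem mult_obj [DecidableEq ι] (c c' : ι) : X.mult c (X.obj c') = if c = c' then 1 else 0 := by
  rw [mult]
  split_ifs with h
  · subst h
    exact finrank_endomorphism_simple_eq_one ℂ _
  · exact finrank_hom_simple_simple_eq_zero_of_not_iso ℂ fun e => h (X.eq_of_iso _ _ ⟨e⟩)

set_option linter.unusedSectionVars false in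
theorem mult_congr (c : ι) {A B : C} (e : A ≅ B) : X.mult c A = X.mult c B :=
  (Linear.homCongr ℂ (Iso.refl _) e).finrank_eq

/-- A cyclic family of linear functionals on endomorphisms is determined by its values on simple
objects. -/
theorem cyclic_eq_sum [Fintype ι] (Φ : ∀ A : C, (A ⟶ A) →ₗ[ℂ] ℂ)
    (hΦ : ∀ {A B : C} (f : A ⟶ B) (g : B ⟶ A), Φ A (f ≫ g) = Φ B (g ≫ f)) {A : C} (f : A ⟶ A) :
    Φ A f = ∑ c, Φ (X.obj c) (𝟙 _) * homTrace (X.obj c) A f := by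
  classical
  obtain ⟨m, l, p, q, hpq, -⟩ := X.exists_decomposition A
  -- Any cyclic functional sees only the diagonal blocks of `f` in the decomposition, which are
  -- scalars. This is used both for `Φ` and for each `homTrace`, whose values on simple identities
  -- are Kronecker deltas.
  have key (Ψ : ∀ A : C, (A ⟶ A) →ₗ[ℂ] ℂ)
      (hΨ : ∀ {A B : C} (f : A ⟶ B) (g : B ⟶ A), Ψ A (f ≫ g) = Ψ B (g ≫ f)) :
      Ψ A f = ∑ i, scalarOf (q i ≫ f ≫ p i) * Ψ (X.obj (l i)) (𝟙 _) := by
    conv_lhs => rw [← Category.comp_id f, ← hpq, Preadditive.comp_sum, map_sum]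
    refine Finset.sum_congr rfl fun i _ => ?_
    rw [← Category.assoc, hΨ, ← scalarOf_spec (q i ≫ f ≫ p i), map_smul, smul_eq_mul,
      scalarOf_spec]
  rw [key Φ hΦ]
  simp_rw [key (homTrace (X.obj _)) (homTrace_comm _), Finset.mul_sum, homTrace_id]
  have h (c c' : ι) : Module.finrank ℂ (X.obj c ⟶ X.obj c') = if c = c' then 1 else 0 :=
    X.mult_obj c c'
  simp_rw [h]
  rw [Finset.sum_comm]
  refine Finset.sum_congr rfl fun i _ => ?_
  simp [mul_comm]

/-- The trace on `Hom(A, c)` by precomposition is cyclic too and agrees with `homTrace` on simple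
identities, so both agree on `𝟙 A`. -/
theorem finrank_hom_obj [Fintype ι] (A : C) (c : ι) :
    Module.finrank ℂ (A ⟶ X.obj c) = X.mult c A := by
  classical
  have h := X.cyclic_eq_sum (cohomTrace (X.obj c)) (cohomTrace_comm _) (𝟙 A)
  simp_rw [cohomTrace_id, homTrace_id] at h
  have h' (a : ι) : Module.finrank ℂ (X.obj a ⟶ X.obj c) = if a = c then 1 else 0 :=
    X.mult_obj a c
  simp_rw [h'] at h
  rw [mult]
  simp only [Nat.cast_ite, Nat.cast_one, Nat.cast_zero, ite_mul, one_mul, zero_mul,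
    Finset.sum_ite_eq', Finset.mem_univ, if_true] at h
  exact_mod_cast h

/-- The projection to a simple summand is a nonzero idempotent in a one-dimensional algebra, hence
the identity. This is how the dual of a simple object is seen to be simple. -/
theorem exists_iso_of_finrank_end_eq_one {A : C} (h : Module.finrank ℂ (A ⟶ A) = 1) :
    ∃ c, Nonempty (X.obj c ≅ A) := by
  obtain ⟨m, l, p, q, hpq, hqp⟩ := X.exists_decomposition A
  have hA : 𝟙 A ≠ 0 := fun h0 => by
    have : Subsingleton (A ⟶ A) := ⟨fun f g => by
      rw [← Category.comp_id f, ← Category.comp_id g, h0, Limits.comp_zero, Limits.comp_zero]⟩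
    rw [Module.finrank_zero_of_subsingleton] at h
    exact zero_ne_one h
  obtain ⟨i⟩ : Nonempty (Fin m) := by
    by_contra hm
    rw [not_nonempty_iff] at hm
    exact hA (by rw [← hpq, Finset.univ_eq_empty, Finset.sum_empty])
  obtain ⟨s, hs⟩ := (finrank_eq_one_iff_of_nonzero' _ hA).1 h (p i ≫ q i)
  have hq : s • q i = q i := by
    have := congrArg (q i ≫ ·) hs
    simpa [reassoc_of% (hqp i)] using this
  have hs1 : s = 1 := by
    by_contra hne
    have h0 : (s - 1) • q i = 0 := by rw [sub_smul, hq, one_smul, sub_self]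
    have hq0 := (smul_eq_zero.1 h0).resolve_left (sub_ne_zero.2 hne)
    have := hqp i
    rw [hq0, Limits.zero_comp] at this
    exact id_nonzero _ this.symm
  exact ⟨l i, ⟨⟨q i, p i, hqp i, by rw [← hs, hs1, one_smul]⟩⟩⟩

theorem exists_iso_rightDual (a : ι) : ∃ c, Nonempty (X.obj c ≅ (X.obj a)ᘁ) :=
  X.exists_iso_of_finrank_end_eq_one (by
    rw [finrank_end_rightDual, finrank_endomorphism_simple_eq_one])

/-- The label of the dual object. -/
noncomputable def dual (a : ι) : ι := (X.exists_iso_rightDual a).choose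

/-- The dual of a simple object is the object of the dual label. -/
noncomputable def dualIso (a : ι) : X.obj (X.dual a) ≅ (X.obj a)ᘁ :=
  (X.exists_iso_rightDual a).choose_spec.some

/-- The reciprocity `N_{ab}^c = N_{a*c}^b`, from which orthogonality of characters follows. -/
theorem mult_tensor_obj [Fintype ι] (a b c : ι) :
    X.mult c (X.obj a ⊗ X.obj b) = X.mult b (X.obj (X.dual a) ⊗ X.obj c) := by
  rw [X.mult_congr b (whiskerRightIso (X.dualIso a) _), ← X.finrank_hom_obj _ b,
    finrank_tensor_left_hom (X.obj a) (X.obj a)ᘁ, mult]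

theorem mult_zero_tensor [Fintype ι] [DecidableEq ι] (a b : ι) :
    X.mult X.zero (X.obj a ⊗ X.obj b) = if b = X.dual a then 1 else 0 := by
  rw [mult_tensor_obj, ← X.mult_obj]
  exact X.mult_congr b (whiskerLeftIso _ X.unit_iso.some ≪≫ ρ_ _)

end SimpleObjects

end Scalars

/-! ### Quantum traces and encircling scalars in a ribbon fusion category. -/

section RibbonFusion

variable {C : Type u} [Category.{v} C] [Abelian C] [Linear ℂ C] [MonoidalCategory C]
  [MonoidalPreadditive C] [MonoidalLinear ℂ C] [RigidCategory C] [BraidedCategory C]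
  [RibbonCategory C]

/-- The partial closure of the right strand, as a linear map. -/
noncomputable def closeRightStrandₗ (A B : C) : (A ⊗ B ⟶ A ⊗ B) →ₗ[ℂ] (A ⟶ A) where
  toFun := closeRightStrand
  map_add' f g := by simp [closeRightStrand]
  map_smul' r f := by simp [closeRightStrand]

theorem closeRightStrand_smul {A B : C} (r : ℂ) (f : A ⊗ B ⟶ A ⊗ B) :
    closeRightStrand (r • f) = r • closeRightStrand f :=
  map_smul (closeRightStrandₗ A B) r f

variable [IsFusionCategory C]

/-- The quantum trace as a linear functional. -/
noncomputable def qTraceₗ (A : C) : (A ⟶ A) →ₗ[ℂ] ℂ where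
  toFun := qTrace
  map_add' f g := by simp [qTrace, qTraceHom, scalarOf_add]
  map_smul' r f := by simp [qTrace, qTraceHom, scalarOf_smul]

theorem qTrace_smul {A : C} (r : ℂ) (f : A ⟶ A) : qTrace (r • f) = r * qTrace f :=
  map_smul (qTraceₗ A) r f

theorem qTrace_comm {A B : C} (f : A ⟶ B) (g : B ⟶ A) : qTrace (f ≫ g) = qTrace (g ≫ f) := by
  rw [qTrace, qTraceHom_comp_comm, qTrace]

theorem qTrace_id_congr {A B : C} (e : A ≅ B) : qTrace (𝟙 A) = qTrace (𝟙 B) := by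
  rw [← e.hom_inv_id, qTrace_comm, e.inv_hom_id]

theorem closureInvariant_eq_qTrace {A B : C} (f : A ⊗ B ⟶ A ⊗ B) :
    closureInvariant f = qTrace f := by
  rw [closureInvariant, closureHom_eq_qTraceHom, qTrace]

theorem qTrace_id_rightDual (A : C) : qTrace (𝟙 Aᘁ) = qTrace (𝟙 A) := by
  rw [qTrace, qTraceHom_id_rightDual, qTrace]

theorem qTrace_tensor {A B : C} (f : A ⊗ B ⟶ A ⊗ B) :
    qTrace f = qTrace (closeRightStrand f) := by
  rw [← closureInvariant_eq_qTrace]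
  rfl

/-- The invariant of the Hopf link, as the trace of the double braiding. -/
noncomputable def hopfTrace (A B : C) : ℂ := qTrace ((β_ A B).hom ≫ (β_ B A).hom)

theorem hopfTrace_comm (A B : C) : hopfTrace A B = hopfTrace B A := qTrace_comm _ _

theorem hopfTrace_congr_left {A A' : C} (e : A ≅ A') (B : C) :
    hopfTrace A B = hopfTrace A' B := by
  have h := qTrace_comm (e.hom ▷ B) ((β_ A' B).hom ≫ (β_ B A').hom ≫ e.inv ▷ B)
  simp only [Category.assoc, inv_hom_whiskerRight, Category.comp_id] at h
  have h' := whiskerRight_comp_doubleBraiding e.hom B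
  simp only [Category.assoc] at h'
  rw [reassoc_of% h', hom_inv_whiskerRight, Category.comp_id] at h
  exact h

theorem hopfTrace_congr_right (A : C) {B B' : C} (e : B ≅ B') :
    hopfTrace A B = hopfTrace A B' := by
  rw [hopfTrace_comm, hopfTrace_congr_left e, hopfTrace_comm]

/-- The scalar by which a closed strand `A` around the simple strand `Z` acts. -/
noncomputable def encircleScalar (Z A : C) [Simple Z] : ℂ := scalarOf (encircle Z A)

theorem encircleScalar_smul (Z A : C) [Simple Z] : encircleScalar Z A • 𝟙 Z = encircle Z A :=
  scalarOf_spec _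

theorem hopfTrace_eq (Z A : C) [Simple Z] :
    hopfTrace Z A = encircleScalar Z A * qTrace (𝟙 Z) := by
  rw [hopfTrace, qTrace_tensor, ← encircle, ← encircleScalar_smul, qTrace_smul]

/-- A loop coloured by `A ⊗ B` is two nested loops; the inner one acts on the simple strand `Z` by a
scalar, which factors out of the outer one. -/
theorem encircleScalar_tensor (Z A B : C) [Simple Z] :
    encircleScalar Z (A ⊗ B) = encircleScalar Z A * encircleScalar Z B := by
  refine scalarOf_eq ?_
  rw [encircle_tensor, ← encircleScalar_smul Z B, MonoidalLinear.whiskerLeft_smul,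
    whiskerLeft_id, Linear.smul_comp, Linear.comp_smul, Category.id_comp, closeRightStrand_smul,
    ← encircle, ← encircleScalar_smul Z A, smul_smul, mul_comm]

/-- Closing `A` beside a strand coloured by the unit leaves a multiple of `𝟙 (𝟙_ C)`, while `𝟙_ C ⊗
A` is isomorphic to `A`. Hence the dimension of the unit is idempotent; nondegeneracy later makes it
`1`. -/
theorem qTrace_id_mul_unit (A : C) :
    qTrace (𝟙 A) * qTrace (𝟙 (𝟙_ C)) = qTrace (𝟙 A) := by
  have h : closeRightStrand (𝟙 (𝟙_ C ⊗ A)) = qTrace (𝟙 A) • 𝟙 (𝟙_ C) := by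
    rw [qTrace, scalarOf_spec, qTraceHom_eq_closeRightStrand, whiskerLeft_id]
  rw [← qTrace_smul, ← h, ← qTrace_tensor, qTrace_id_congr (λ_ A)]

namespace SimpleObjects

variable {ι : Type w} [Fintype ι] (X : SimpleObjects C ι)

theorem qTrace_eq_sum {A : C} (f : A ⟶ A) :
    qTrace f = ∑ c, X.d c * homTrace (X.obj c) A f :=
  X.cyclic_eq_sum qTraceₗ (fun f g => qTrace_comm f g) f

theorem encircleScalar_eq_sum (Z A : C) [Simple Z] :
    encircleScalar Z A = ∑ c, encircleScalar Z (X.obj c) * X.mult c A := by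
  let Φ (A : C) : (A ⟶ A) →ₗ[ℂ] ℂ :=
    { toFun := fun f => scalarOf (closeRightStrand (Z ◁ f ≫ (β_ Z A).hom ≫ (β_ A Z).hom))
      map_add' := fun f g => by
        rw [MonoidalPreadditive.whiskerLeft_add, Preadditive.add_comp, ← scalarOf_add]
        congr 1
        exact map_add (closeRightStrandₗ Z A) _ _
      map_smul' := fun r f => by
        rw [MonoidalLinear.whiskerLeft_smul, Linear.smul_comp, closeRightStrand_smul,
          scalarOf_smul]
        rfl }
  have hid (A : C) : Φ A (𝟙 A) = encircleScalar Z A := by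
    simp [Φ, encircleScalar, encircle]
  have h := X.cyclic_eq_sum Φ
    (fun f g => congrArg scalarOf (braiding_comp_whiskerLeft_encircle f g)) (𝟙 A)
  simp_rw [hid, homTrace_id] at h
  exact h

theorem qTrace_whiskerRight_doubleBraiding {A : C} (f : A ⟶ A) (Z : C) :
    qTrace (f ▷ Z ≫ (β_ A Z).hom ≫ (β_ Z A).hom) =
      ∑ c, hopfTrace (X.obj c) Z * homTrace (X.obj c) A f := by
  let Φ (A : C) : (A ⟶ A) →ₗ[ℂ] ℂ :=
    { toFun := fun f => qTrace (f ▷ Z ≫ (β_ A Z).hom ≫ (β_ Z A).hom)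
      map_add' := fun f g => by
        rw [MonoidalPreadditive.add_whiskerRight, Preadditive.add_comp]
        exact map_add (qTraceₗ _) _ _
      map_smul' := fun r f => by
        rw [MonoidalLinear.smul_whiskerRight, Linear.smul_comp, qTrace_smul]
        rfl }
  have hid (A : C) : Φ A (𝟙 A) = hopfTrace A Z := by
    simp [Φ, hopfTrace]
  have h := X.cyclic_eq_sum Φ (fun {A B} f g => by
    change qTrace _ = qTrace _
    rw [comp_whiskerRight_assoc, whiskerRight_comp_doubleBraiding, qTrace_comm,
      comp_whiskerRight_assoc]
    have hf := whiskerRight_comp_doubleBraiding f Z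
    have hg := whiskerRight_comp_doubleBraiding g Z
    simp only [Category.assoc] at hf hg ⊢
    rw [← reassoc_of% hg, hf]) f
  simp_rw [hid] at h
  exact h

end SimpleObjects

end RibbonFusion

/-! ### Integer powers of braidings acting on multiplicity spaces. -/

section Powers

theorem aut_mul_hom {C : Type u} [Category.{v} C] {A : C} (e f : Aut A) :
    (e * f).hom = f.hom ≫ e.hom := rfl

theorem selfBraiding_zpow_hom {C : Type u} [Category.{v} C] [MonoidalCategory C]
    [BraidedCategory C] (A : C) (n : ℤ) :
    (selfBraiding A ^ (2 * n + 1)).hom = (doubleBraiding A A ^ n).hom ≫ (β_ A A).hom := by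
  have h : selfBraiding A ^ (2 : ℤ) = doubleBraiding A A := by
    rw [zpow_two]
    rfl
  rw [add_comm, zpow_add, zpow_mul, h, zpow_one]
  rfl

variable {C : Type u} [Category.{v} C] [Preadditive C] [Linear ℂ C]

theorem comp_aut_zpow_hom {A P : C} {e : Aut A} {r : ℂ} (hr : r ≠ 0)
    (he : ∀ v : P ⟶ A, v ≫ e.hom = r • v) (n : ℤ) (v : P ⟶ A) :
    v ≫ (e ^ n).hom = r ^ n • v := by
  have key {e : Aut A} {r : ℂ} (he : ∀ v : P ⟶ A, v ≫ e.hom = r • v) (n : ℕ) (v : P ⟶ A) :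
      v ≫ (e ^ n).hom = r ^ n • v := by
    induction n with
    | zero =>
      rw [pow_zero, pow_zero, one_smul]
      exact Category.comp_id v
    | succ n ih =>
      rw [pow_succ', aut_mul_hom, ← Category.assoc, ih, Linear.smul_comp, he,
        smul_smul, pow_succ]
  cases n with
  | ofNat n => simpa using key he n v
  | negSucc n =>
    have he' (v : P ⟶ A) : v ≫ (e⁻¹).hom = r⁻¹ • v := by
      have h := he (v ≫ (e⁻¹).hom)
      have hinv : (e⁻¹).hom ≫ e.hom = 𝟙 A := e.inv_hom_id
      rw [Category.assoc, hinv, Category.comp_id] at h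
      conv_rhs => rw [h, smul_smul, inv_mul_cancel₀ hr, one_smul]
    rw [zpow_negSucc, zpow_negSucc, ← inv_pow, ← inv_pow]
    exact key he' _ v

end Powers

section BraidPowers

variable {C : Type u} [Category.{v} C] [Abelian C] [Linear ℂ C] [MonoidalCategory C]
  [MonoidalPreadditive C] [MonoidalLinear ℂ C] [RigidCategory C] [BraidedCategory C]
  [RibbonCategory C] [IsFusionCategory C]

/-- The scalar of the twist of a simple object is nonzero. -/
theorem scalarOf_twist_ne_zero (A : C) [Simple A] :
    scalarOf (RibbonCategory.twist A).hom ≠ 0 := fun h => by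
  have h' := scalarOf_spec (RibbonCategory.twist A).hom
  rw [h, zero_smul] at h'
  have := (RibbonCategory.twist A).hom_inv_id
  rw [← h', Limits.zero_comp] at this
  exact id_nonzero A this.symm

/-- Naturality of the twist along `f`, with the twist of `A ⊗ B` written as the two twists followed
by the double braiding. -/
theorem comp_doubleBraiding_hom {E A B : C} [Simple E] [Simple A] [Simple B] (f : E ⟶ A ⊗ B) :
    f ≫ (doubleBraiding A B).hom =
      (scalarOf (RibbonCategory.twist E).hom / (scalarOf (RibbonCategory.twist A).hom *
        scalarOf (RibbonCategory.twist B).hom)) • f := by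
  have h := RibbonCategory.twist_naturality f
  rw [RibbonCategory.twist_tensor, ← scalarOf_spec (RibbonCategory.twist E).hom,
    ← scalarOf_spec (RibbonCategory.twist A).hom, ← scalarOf_spec (RibbonCategory.twist B).hom,
    MonoidalCategory.tensorHom_def] at h
  simp only [MonoidalLinear.smul_whiskerRight, MonoidalLinear.whiskerLeft_smul, id_whiskerRight,
    whiskerLeft_id, Linear.smul_comp, Linear.comp_smul, Category.id_comp, smul_smul] at h
  have hA := scalarOf_twist_ne_zero A
  have hB := scalarOf_twist_ne_zero B
  rw [div_eq_inv_mul, mul_smul, h, smul_smul, mul_comm (scalarOf (RibbonCategory.twist B).hom), inv_mul_cancel₀ (mul_ne_zero hA hB), one_smul]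
  rfl

theorem homTrace_oddBraid (E A : C) [Simple E] [Simple A] (n : ℤ) :
    homTrace E (A ⊗ A) (oddBraid A n) =
      (scalarOf (RibbonCategory.twist E).hom / scalarOf (RibbonCategory.twist A).hom ^ 2) ^ n *
        homTrace E (A ⊗ A) (β_ A A).hom := by
  rw [homTrace_apply, homTrace_apply, ← smul_eq_mul, ← map_smul]
  congr 1
  ext f
  have hr := div_ne_zero (scalarOf_twist_ne_zero E)
    (mul_ne_zero (scalarOf_twist_ne_zero A) (scalarOf_twist_ne_zero A))
  have h := comp_aut_zpow_hom hr comp_doubleBraiding_hom n f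
  simp only [oddBraid, selfBraiding_zpow_hom, Linear.rightComp_apply, LinearMap.smul_apply]
  rw [← Category.assoc, h, Linear.smul_comp, sq]

theorem homTrace_evenBraid (E A B : C) [Simple E] [Simple A] [Simple B] (n : ℤ) :
    homTrace E (A ⊗ B) (evenBraid A B n) =
      (scalarOf (RibbonCategory.twist E).hom / (scalarOf (RibbonCategory.twist A).hom *
        scalarOf (RibbonCategory.twist B).hom)) ^ n * Module.finrank ℂ (E ⟶ A ⊗ B) := by
  rw [← homTrace_id, homTrace_apply, homTrace_apply, ← smul_eq_mul, ← map_smul]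
  congr 1
  ext f
  have hr := div_ne_zero (scalarOf_twist_ne_zero E)
    (mul_ne_zero (scalarOf_twist_ne_zero A) (scalarOf_twist_ne_zero B))
  have h := comp_aut_zpow_hom hr comp_doubleBraiding_hom n f
  simpa [evenBraid] using h

set_option linter.unusedSectionVars false in
theorem sum_rSymbol_eq_homTrace {E A : C} {κ : Type*} [Fintype κ]
    (b : Module.Basis κ ℂ (E ⟶ A ⊗ A)) :
    ∑ μ, rSymbol b b μ μ = homTrace E (A ⊗ A) (β_ A A).hom := by
  classical
  rw [homTrace_apply, LinearMap.trace_eq_matrix_trace ℂ b]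
  refine Finset.sum_congr rfl fun μ _ => ?_
  rw [Matrix.diag_apply, LinearMap.toMatrix_apply]
  rfl

/-- The trace of the double braiding squared, from the trace of the braiding on the multiplicity
spaces. -/
theorem sum_hopfTrace_mul_homTrace_braiding {ι : Type w} [Fintype ι] (X : SimpleObjects C ι)
    (A Z : C) [Simple A] :
    ∑ c, hopfTrace (X.obj c) Z * homTrace (X.obj c) (A ⊗ A) (β_ A A).hom =
      scalarOf (RibbonCategory.twist A).hom * qTrace (evenBraid Z A 2) := by
  rw [← X.qTrace_whiskerRight_doubleBraiding, qTrace, qTraceHom_braiding_encircled, ← qTrace]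
  conv_lhs => rw [← scalarOf_spec (RibbonCategory.twist A).hom]
  rw [MonoidalLinear.whiskerLeft_smul, whiskerLeft_id, Linear.smul_comp, Linear.comp_smul,
    Linear.comp_smul, qTrace_smul, Category.id_comp, evenBraid, zpow_two, aut_mul_hom]
  simp [doubleBraiding]

end BraidPowers

/-! ### Orthogonality of characters and the Verlinde formula. -/

section Modular

variable {C : Type u} [Category.{v} C] [Abelian C] [Linear ℂ C] [MonoidalCategory C]
  [MonoidalPreadditive C] [MonoidalLinear ℂ C] [RigidCategory C] [BraidedCategory C]
  [RibbonCategory C] [IsModularCategory C]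

namespace SimpleObjects

variable {ι : Type w} (X : SimpleObjects C ι)

/-- The character of the fusion ring belonging to the label `z`, evaluated at `a`. -/
noncomputable def character (z a : ι) : ℂ := encircleScalar (X.obj z) (X.obj a)

/-- The invariant of the Hopf link coloured by the labels `z` and `a`. -/
noncomputable def hopf (z a : ι) : ℂ := hopfTrace (X.obj z) (X.obj a)

theorem hopf_comm (z a : ι) : X.hopf z a = X.hopf a z := hopfTrace_comm _ _

theorem hopf_eq (z a : ι) : X.hopf z a = X.character z a * X.d z := hopfTrace_eq _ _

theorem hopfLink_obj (a b : ι) : hopfLink (X.obj a) (X.obj b) = X.hopf a (X.dual b) :=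
  hopfTrace_congr_right _ (X.dualIso b).symm

theorem hopf_zero_left (a : ι) : X.hopf X.zero a = X.d a := by
  rw [hopf, hopfTrace_congr_left X.unit_iso.some, hopfTrace, d, ← qTrace_id_congr (λ_ (X.obj a))]
  congr 1
  simp [braiding_tensorUnit_left, braiding_tensorUnit_right]

theorem d_dual (a : ι) : X.d (X.dual a) = X.d a := by
  rw [d, qTrace_id_congr (X.dualIso a), qTrace_id_rightDual, d]

variable [Fintype ι]

/-- The braiding makes the multiplicity of the unit in `a ⊗ a*` and in `a* ⊗ a` equal; the latter is
nonzero only if `a` is the dual of `a*`. -/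
theorem dual_dual (a : ι) : X.dual (X.dual a) = a := by
  classical
  have h := X.mult_congr X.zero (β_ (X.obj a) (X.obj (X.dual a)))
  rw [mult_zero_tensor, mult_zero_tensor, if_pos rfl] at h
  by_contra hne
  rw [if_neg fun h' => hne h'.symm] at h
  exact absurd h one_ne_zero

/-- The involution of labels given by duality. -/
noncomputable def dualEquiv : ι ≃ ι := Function.Involutive.toPerm X.dual X.dual_dual

theorem dual_injective : Function.Injective X.dual := X.dualEquiv.injective

theorem eq_zero_of_sum_mul_hopf (r : ι → ℂ) (hr : ∀ j, ∑ i, r i * X.hopf i j = 0) : r = 0 := by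
  let e := Fintype.equivFin ι
  let Y : SimpleObjects C (Fin (Fintype.card ι)) :=
    { obj := fun i => X.obj (e.symm i)
      simple := fun i => X.simple _
      eq_of_iso := fun i j h => e.symm.injective (X.eq_of_iso _ _ h)
      exhaustive := fun A hA => by
        obtain ⟨i, hi⟩ := X.exhaustive A hA
        exact ⟨e i, by simpa using hi⟩
      zero := e X.zero
      unit_iso := by simpa using X.unit_iso }
  have hdet := (IsModularCategory.nondegenerate _ Y).ne_zero
  have h := Matrix.eq_zero_of_vecMul_eq_zero (v := fun i => r (e.symm i)) hdet (by
    ext j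
    -- The nondegenerate matrix `hopfLink` has its second label dualized relative to `hopf`.
    have hj := hr (X.dual (e.symm j))
    rw [← e.symm.sum_comp] at hj
    simpa [Matrix.vecMul, dotProduct, Y, hopfLink_obj] using hj)
  ext i
  simpa using congrFun h (e i)

/-- Row `z` of the Hopf matrix is `d_z` times a character, so it would vanish with `d_z`. -/
theorem d_ne_zero (z : ι) : X.d z ≠ 0 := fun h => by
  classical
  have := X.eq_zero_of_sum_mul_hopf (Pi.single z 1) fun j => by
    simp [Pi.single_apply, hopf_eq, h]
  simpa using congrFun this z

theorem d_zero : X.d X.zero = 1 := by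
  have h := qTrace_id_mul_unit (X.obj X.zero)
  rw [← qTrace_id_congr X.unit_iso.some] at h
  exact (mul_eq_left₀ (X.d_ne_zero X.zero)).1 h

theorem character_zero_right (z : ι) : X.character z X.zero = 1 := by
  have h := X.hopf_eq z X.zero
  rw [hopf_comm, hopf_zero_left] at h
  exact (mul_eq_right₀ (X.d_ne_zero z)).1 h.symm

theorem character_zero_left (a : ι) : X.character X.zero a = X.d a := by
  rw [← hopf_zero_left, hopf_eq, d_zero, mul_one]

theorem character_mul (z a b : ι) : X.character z a * X.character z b =
    ∑ c, X.character z c * X.mult c (X.obj a ⊗ X.obj b) := by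
  rw [character, character, ← encircleScalar_tensor, X.encircleScalar_eq_sum]
  rfl

/-- Multiplication by `a` in the fusion ring has multiplication by `a*` as its adjoint
(`mult_tensor_obj`), and both characters are eigenvectors. For `z = w` the inner product is nonzero,
so conjugation is duality; for `z ≠ w` a nonzero inner product would force equal characters. -/
theorem character_mul_sum (z w a : ι) :
    X.character z a * ∑ b, X.character z b * conj (X.character w b) =
      conj (X.character w (X.dual a)) * ∑ b, X.character z b * conj (X.character w b) := by
  calc
    _ = ∑ b, ∑ c, X.character z c * conj (X.character w b) * X.mult c (X.obj a ⊗ X.obj b) := by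
      rw [Finset.mul_sum]
      refine Finset.sum_congr rfl fun b _ => ?_
      rw [← mul_assoc, character_mul, Finset.sum_mul]
      exact Finset.sum_congr rfl fun c _ => by ring
    _ = ∑ c, X.character z c *
          conj (∑ b, X.character w b * X.mult b (X.obj (X.dual a) ⊗ X.obj c)) := by
      rw [Finset.sum_comm]
      refine Finset.sum_congr rfl fun c _ => ?_
      rw [map_sum, Finset.mul_sum]
      refine Finset.sum_congr rfl fun b _ => ?_
      rw [mult_tensor_obj, map_mul, Complex.conj_natCast]
      ring
    _ = _ := by
      rw [Finset.mul_sum]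
      refine Finset.sum_congr rfl fun c _ => ?_
      rw [← character_mul, map_mul]
      ring

theorem sum_character_mul_conj_ne_zero (z : ι) :
    ∑ b, X.character z b * conj (X.character z b) ≠ 0 := by
  simp_rw [Complex.mul_conj]
  rw [← Complex.ofReal_sum, Complex.ofReal_ne_zero]
  refine (Finset.sum_pos' (fun i _ => Complex.normSq_nonneg _) ⟨X.zero, Finset.mem_univ _, ?_⟩).ne'
  rw [character_zero_right]
  simp

theorem conj_character (z a : ι) : conj (X.character z a) = X.character z (X.dual a) := by
  have h := mul_right_cancel₀ (X.sum_character_mul_conj_ne_zero z) (X.character_mul_sum z z a)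
  rw [h]
  have h' := mul_right_cancel₀ (X.sum_character_mul_conj_ne_zero z)
    (X.character_mul_sum z z (X.dual a))
  rw [h', dual_dual, Complex.conj_conj, h, Complex.conj_conj]

theorem sum_character_mul_conj_eq_zero {z w : ι} (hzw : z ≠ w) :
    ∑ b, X.character z b * conj (X.character w b) = 0 := by
  classical
  by_contra hne
  have h (a : ι) : X.character z a = X.character w a := by
    have := mul_right_cancel₀ hne (X.character_mul_sum z w a)
    rwa [← conj_character, Complex.conj_conj] at this
  -- Equal characters make rows `z` and `w` of the Hopf matrix proportional, with ratio `d_z : d_w`.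
  have h0 := X.eq_zero_of_sum_mul_hopf (Pi.single z (X.d w) - Pi.single w (X.d z)) fun j => by
    simp [Pi.single_apply, sub_mul, hopf_eq, h]
    ring
  have := congrFun h0 z
  simp [hzw, X.d_ne_zero] at this

theorem conj_d (a : ι) : conj (X.d a) = X.d a := by
  rw [← character_zero_left, conj_character, character_zero_left, d_dual, character_zero_left]

theorem conj_hopf (a b : ι) : conj (X.hopf a b) = X.hopf a (X.dual b) := by
  rw [hopf_eq, map_mul, conj_character, conj_d, hopf_eq]

theorem sum_hopf_mul_d [DecidableEq ι] (a : ι) :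
    ∑ z, X.hopf a z * X.d z = if a = X.zero then ∑ z, X.d z ^ 2 else 0 := by
  split_ifs with h
  · subst h
    simp_rw [hopf_zero_left, sq]
  · have h0 := X.sum_character_mul_conj_eq_zero h
    simp_rw [character_zero_left, conj_d] at h0
    simp_rw [hopf_eq, mul_right_comm _ (X.d a)]
    rw [← Finset.sum_mul, h0, zero_mul]

/-- Fusing the loops `a` and `b*` reduces the sum to `sum_hopf_mul_d`, where only the unit channel
survives; its multiplicity is `1` exactly when `a = b`. -/
theorem sum_hopf_mul_conj_hopf [DecidableEq ι] (a b : ι) :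
    ∑ z, X.hopf a z * conj (X.hopf b z) = if a = b then ∑ z, X.d z ^ 2 else 0 := by
  have h (z : ι) : X.hopf a z * conj (X.hopf b z) =
      ∑ c, X.mult c (X.obj a ⊗ X.obj (X.dual b)) * (X.hopf c z * X.d z) := by
    rw [X.hopf_comm a, X.hopf_comm b, conj_hopf, hopf_eq, hopf_eq, mul_mul_mul_comm,
      character_mul, Finset.sum_mul]
    refine Finset.sum_congr rfl fun c _ => ?_
    rw [X.hopf_comm c, hopf_eq]
    ring
  simp_rw [h]
  rw [Finset.sum_comm]
  simp_rw [← Finset.mul_sum, sum_hopf_mul_d]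
  simp only [mul_ite, mul_zero, Finset.sum_ite_eq', Finset.mem_univ, if_true, mult_zero_tensor,
    X.dual_injective.eq_iff, Nat.cast_ite, Nat.cast_one, Nat.cast_zero, ite_mul, one_mul, zero_mul,
    eq_comm (a := a)]

theorem sum_d_sq : ∑ a, X.d a ^ 2 = (X.D : ℂ) ^ 2 := by
  have h (a : ι) : X.d a ^ 2 = ((X.d a).re ^ 2 : ℝ) := by
    rw [Complex.ofReal_pow, Complex.conj_eq_iff_re.1 (X.conj_d a)]
  rw [D]
  simp_rw [h]
  rw [← Complex.ofReal_sum, Complex.ofReal_re, ← Complex.ofReal_pow, Real.sq_sqrt]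
  exact Finset.sum_nonneg fun a _ => sq_nonneg _

theorem D_ne_zero : (X.D : ℂ) ≠ 0 := by
  classical
  intro h
  have h' := X.sum_character_mul_conj_ne_zero X.zero
  simp_rw [character_zero_left, conj_d, ← sq] at h'
  rw [sum_d_sq, h] at h'
  simp at h'

theorem S_eq (a b : ι) : X.S a b = X.hopf a (X.dual b) / X.D := by
  rw [S, hopfLink_obj, one_div, div_eq_inv_mul]

theorem S_zero_left (b : ι) : X.S X.zero b = X.d b / X.D := by
  rw [S_eq, hopf_zero_left, d_dual]

theorem hopf_eq_conj_S (a b : ι) : X.hopf a b = X.D * conj (X.S a b) := by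
  rw [S_eq, map_div₀, conj_hopf, dual_dual, Complex.conj_ofReal, mul_div_cancel₀ _ X.D_ne_zero]

/-- The Verlinde formula. -/
theorem verlinde (a b c : ι) : (X.mult c (X.obj a ⊗ X.obj b) : ℂ) =
    ∑ z, X.S a z * X.S b z * conj (X.S c z) / X.S X.zero z := by
  classical
  have hD := X.D_ne_zero
  have h (z : ι) : X.S a (X.dual z) * X.S b (X.dual z) * conj (X.S c (X.dual z)) /
      X.S X.zero (X.dual z) = ∑ e, X.mult e (X.obj a ⊗ X.obj b) / (X.D : ℂ) ^ 2 *
        (X.hopf e z * conj (X.hopf c z)) := by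
    have hz := X.d_ne_zero z
    have hmul : ∑ e, X.mult e (X.obj a ⊗ X.obj b) / (X.D : ℂ) ^ 2 *
        (X.hopf e z * conj (X.hopf c z)) =
        X.character z a * X.character z b * (X.d z * conj (X.hopf c z) / (X.D : ℂ) ^ 2) := by
      rw [character_mul, Finset.sum_mul]
      refine Finset.sum_congr rfl fun e _ => ?_
      rw [X.hopf_comm e, hopf_eq]
      ring
    rw [hmul, S_eq, S_eq, S_eq, S_zero_left, dual_dual, d_dual, X.hopf_comm a, X.hopf_comm b,
      X.hopf_eq z a, X.hopf_eq z b, map_div₀, Complex.conj_ofReal]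
    field_simp
  -- Summing over dual labels removes the dual from the second index of `S`, so that its entries
  -- become `hopf` divided by `D`.
  rw [← X.dualEquiv.sum_comp]
  change _ = ∑ z, X.S a (X.dual z) * X.S b (X.dual z) * conj (X.S c (X.dual z)) /
      X.S X.zero (X.dual z)
  simp_rw [h]
  rw [Finset.sum_comm]
  simp_rw [← Finset.mul_sum, sum_hopf_mul_conj_hopf, sum_d_sq]
  simp [hD]

/-- The invariants of closures of odd powers. -/
theorem oddClosure_eq (a : ι) (n : ℤ) : X.oddClosure a n =
    ∑ c, X.d c * homTrace (X.obj c) (X.obj a ⊗ X.obj a) (β_ (X.obj a) (X.obj a)).hom *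
      (X.θ c / X.θ a ^ 2) ^ n := by
  rw [oddClosure, closureInvariant_eq_qTrace, X.qTrace_eq_sum]
  refine Finset.sum_congr rfl fun c _ => ?_
  rw [homTrace_oddBraid, mul_right_comm, mul_assoc]
  rfl

/-- The invariants of closures of even powers. -/
theorem evenClosure_eq (a b : ι) (n : ℤ) : X.evenClosure a b n =
    ∑ c, ∑ z, X.d c * (X.S a z * X.S b z * conj (X.S c z) / X.S X.zero z) *
      (X.θ c / (X.θ a * X.θ b)) ^ n := by
  rw [evenClosure, closureInvariant_eq_qTrace, X.qTrace_eq_sum]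
  refine Finset.sum_congr rfl fun c _ => ?_
  rw [← Finset.sum_mul, ← Finset.mul_sum, ← verlinde, homTrace_evenBraid, mul_assoc,
    mul_comm (X.mult c _ : ℂ)]
  rfl

theorem sum_hopf_mul_homTrace_braiding (a z : ι) :
    ∑ c, X.hopf c z * homTrace (X.obj c) (X.obj a ⊗ X.obj a) (β_ (X.obj a) (X.obj a)).hom =
      X.θ a * X.evenClosure z a 2 := by
  rw [evenClosure, closureInvariant_eq_qTrace]
  exact sum_hopfTrace_mul_homTrace_braiding X (X.obj a) (X.obj z)

end SimpleObjects

/-! ### Dependence on the modular data only. -/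

section SameModularData

variable {C' : Type u'} [Category.{v'} C'] [Abelian C'] [Linear ℂ C'] [MonoidalCategory C']
  [MonoidalPreadditive C'] [MonoidalLinear ℂ C'] [RigidCategory C'] [BraidedCategory C']
  [RibbonCategory C'] [IsModularCategory C']

namespace SameModularData

variable {ι : Type w} {ι' : Type w'} [Fintype ι] [DecidableEq ι] [Fintype ι'] [DecidableEq ι']
  {X : SimpleObjects C ι} {X' : SimpleObjects C' ι'} {e : ι ≃ ι'}

theorem θ_eq (h : SameModularData X X' e) (a : ι) : X'.θ (e a) = X.θ a := by
  simpa [SimpleObjects.T] using h.T_eq a a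

/-- The entry `S_{00}` equals `1 / D`, since `d_0 = 1`. -/
theorem D_eq (h : SameModularData X X' e) : (X'.D : ℂ) = X.D := by
  have h0 := h.S_eq X.zero X.zero
  rw [h.zero_eq, SimpleObjects.S_zero_left, SimpleObjects.S_zero_left, SimpleObjects.d_zero,
    SimpleObjects.d_zero] at h0
  simpa using h0

theorem d_eq (h : SameModularData X X' e) (a : ι) : X'.d (e a) = X.d a := by
  have h0 := h.S_eq X.zero a
  rw [h.zero_eq, SimpleObjects.S_zero_left, SimpleObjects.S_zero_left, h.D_eq] at h0
  exact (div_left_inj' X.D_ne_zero).1 h0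

theorem hopf_eq (h : SameModularData X X' e) (a b : ι) : X'.hopf (e a) (e b) = X.hopf a b := by
  rw [SimpleObjects.hopf_eq_conj_S, SimpleObjects.hopf_eq_conj_S, h.D_eq, h.S_eq]

theorem evenClosure_eq (h : SameModularData X X' e) (a b : ι) (n : ℤ) :
    X'.evenClosure (e a) (e b) n = X.evenClosure a b n := by
  rw [SimpleObjects.evenClosure_eq, SimpleObjects.evenClosure_eq, ← e.sum_comp]
  refine Finset.sum_congr rfl fun c _ => ?_
  rw [← e.sum_comp]
  refine Finset.sum_congr rfl fun z _ => ?_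
  rw [← h.zero_eq]
  simp only [h.S_eq, h.d_eq, h.θ_eq]

/-- Both families of traces solve the same linear system: its matrix is the common Hopf matrix, its
right side `θ_a` times even closures. Nondegeneracy makes the solution unique. -/
theorem homTrace_braiding_eq (h : SameModularData X X' e) (a c : ι) :
    homTrace (X'.obj (e c)) (X'.obj (e a) ⊗ X'.obj (e a)) (β_ (X'.obj (e a)) (X'.obj (e a))).hom =
      homTrace (X.obj c) (X.obj a ⊗ X.obj a) (β_ (X.obj a) (X.obj a)).hom := by
  have h0 := X.eq_zero_of_sum_mul_hopf
    (fun c => homTrace (X'.obj (e c)) (X'.obj (e a) ⊗ X'.obj (e a))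
      (β_ (X'.obj (e a)) (X'.obj (e a))).hom -
        homTrace (X.obj c) (X.obj a ⊗ X.obj a) (β_ (X.obj a) (X.obj a)).hom) fun z => by
    have h₁ := X.sum_hopf_mul_homTrace_braiding a z
    have h₂ := X'.sum_hopf_mul_homTrace_braiding (e a) (e z)
    rw [← e.sum_comp, h.θ_eq, h.evenClosure_eq, ← h₁] at h₂
    simp_rw [h.hopf_eq] at h₂
    simp_rw [sub_mul, Finset.sum_sub_distrib, mul_comm _ (X.hopf _ z)]
    exact sub_eq_zero.2 h₂
  exact sub_eq_zero.1 (congrFun h0 c)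

theorem oddClosure_eq (h : SameModularData X X' e) (a : ι) (n : ℤ) :
    X'.oddClosure (e a) n = X.oddClosure a n := by
  rw [SimpleObjects.oddClosure_eq, SimpleObjects.oddClosure_eq, ← e.sum_comp]
  refine Finset.sum_congr rfl fun c _ => ?_
  rw [h.homTrace_braiding_eq, h.d_eq, h.θ_eq, h.θ_eq]

end SameModularData

end SameModularData

end Modular

theorem mainTheorem5
    {C : Type u} [Category.{v} C] [Abelian C] [Linear ℂ C] [MonoidalCategory C]
    [MonoidalPreadditive C] [MonoidalLinear ℂ C] [RigidCategory C] [BraidedCategory C]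
    [RibbonCategory C] [IsModularCategory C]
    {ι : Type w} [Fintype ι] [DecidableEq ι] (X : SimpleObjects C ι) :
    -- knots
    (∀ (a : ι) (n : ℤ) (κ : ι → Type k) [∀ c, Fintype (κ c)]
        (b : ∀ c, Module.Basis (κ c) ℂ (X.obj c ⟶ X.obj a ⊗ X.obj a)),
      X.oddClosure a n = qTrace (oddBraid (X.obj a) n) ∧
      qTrace (oddBraid (X.obj a) n) =
        ∑ c, X.d c * (∑ μ, rSymbol (b c) (b c) μ μ) * (X.θ c / X.θ a ^ 2) ^ n) ∧
    -- two-component links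
    (∀ (a b : ι) (n : ℤ),
      X.evenClosure a b n = qTrace (evenBraid (X.obj a) (X.obj b) n) ∧
      qTrace (evenBraid (X.obj a) (X.obj b) n) =
        ∑ c, ∑ z, X.d c * (X.S a z * X.S b z * conj (X.S c z) / X.S X.zero z) *
          (X.θ c / (X.θ a * X.θ b)) ^ n) ∧
    -- the invariants are determined by the modular data
    (∀ (C' : Type u') [Category.{v'} C'] [Abelian C'] [Linear ℂ C'] [MonoidalCategory C']
        [MonoidalPreadditive C'] [MonoidalLinear ℂ C'] [RigidCategory C'] [BraidedCategory C']
        [RibbonCategory C'] [IsModularCategory C']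
        (ι' : Type w') [Fintype ι'] [DecidableEq ι'] (X' : SimpleObjects C' ι') (e : ι ≃ ι'),
      SameModularData X X' e →
        (∀ (a : ι) (n : ℤ), X'.oddClosure (e a) n = X.oddClosure a n) ∧
        (∀ (a b : ι) (n : ℤ), X'.evenClosure (e a) (e b) n = X.evenClosure a b n)) := by
  refine ⟨fun a n κ _ b => ⟨closureInvariant_eq_qTrace _, ?_⟩,
    fun a b n => ⟨closureInvariant_eq_qTrace _, ?_⟩, fun C' _ _ _ _ _ _ _ _ _ _ ι' _ _ X' e h =>
      ⟨h.oddClosure_eq, h.evenClosure_eq⟩⟩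
  · simp_rw [sum_rSymbol_eq_homTrace]
    rw [← X.oddClosure_eq]
    exact (closureInvariant_eq_qTrace _).symm
  · rw [← X.evenClosure_eq]
    exact (closureInvariant_eq_qTrace _).symm
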